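/- Let $d\ge 1$ and let $p(i,j)$, $i,j\in\mathbb Z^d$, be a Markov transition function on $\mathbb Z^d$ that is translation invariant and symmetric ($p(i,j)=p(j,i)=p(0,j-i)$), of finite range ($p(i,j)=0$ for $|i-j|>R$, for some $R>0$) and irreducible. Let $(X_t)_{t\ge 0}$ be the continuous-time random walk on $\mathbb Z^d$ started at $0$ that jumps at rate $1$ according to $p$, i.e. the right-continuous process with $X_0=0$ and with stationary independent increments such that, as $h\downarrow 0$, $P(X_h=y)=h\,p(0,y)+o(h)$ for $y\ne 0$ and $P(X_h=0)=1-h(1-p(0,0))+o(h)$. Write $p^{RW}_t(x)=P(X_t=x)$, let $\Gamma=\big(\sum_{z\in\mathbb Z^d}p(0,z)\,z_az_b\big)_{a,b}$ be the covariance matrix of one jump, and let $$\bar p_t(x)=\frac{1}{(2\pi t)^{d/2}\sqrt{\det\Gamma}}\;e^{-\frac{x\cdot\Gamma^{-1}x}{2t}}$$ be the density of the centred Gaussian law with covariance $t\,\Gamma$. Then for every $M\ge 0$ there is a constant $c>0$, depending only on $M$, $d$ and $p$, such that for all $t>0$ $$\sup_{x\in\mathbb Z^d,\ |x|\le M\sqrt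 t}\left|\frac{p^{RW}_t(x)}{\bar p_t(x)}-1\right|\le\frac{c}{\sqrt t},$$ where $|x|$ is the Euclidean norm. If $\Gamma=\frac1d I$ (as for the simple random walk), then $$\bar p_t(x)=\frac{(\sqrt d)^{\,d}}{(2\pi t)^{d/2}}\,e^{-\frac{d|x|^2}{2t}}\qquad\text{for all } t>0 \text{ and } x\in\mathbb Z^d.$$ -/

import Mathlib

open MeasureTheory ProbabilityTheory Filter Topology
open scoped NNReal Matrix

/-- A translation invariant, symmetric, irreducible Markov transition function of finite range
on `ℤ^d`. The range is measured in the sup distance of `Fin d → ℤ`; since any `R` is allowed, this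
is the same as finite range in the Euclidean distance. -/
structure IsJumpKernel {d : ℕ} (p : (Fin d → ℤ) → (Fin d → ℤ) → ℝ) : Prop where
  nonneg : ∀ i j, 0 ≤ p i j
  symm : ∀ i j, p i j = p j i
  translation : ∀ i j, p i j = p 0 (j - i)
  sum_one : ∀ i, HasSum (fun j => p i j) 1
  finite_range : ∃ R : ℝ, 0 < R ∧ ∀ i j, R < dist i j → p i j = 0
  irreducible : ∀ x y, Relation.ReflTransGen (fun i j => 0 < p i j) x y

/-- `X` is a continuous-time random walk on `ℤ^d` started at the origin, which waits at each site
an exponential time of rate one and then jumps from `i` to `j` with probability `p i j`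
(the Markov process with generator `L f(i) = ∑ j, p(i,j) (f(j) - f(i))`): a right-continuous process
with stationary independent increments whose one-time distributions satisfy, as `h ↓ 0`,
`P(X_h = y) = h p(0,y) + o(h)` for `y ≠ 0`, and `P(X_h = 0) = 1 - h (1 - p(0,0)) + o(h)`. -/
structure IsContinuousTimeRandomWalk {d : ℕ} (p : (Fin d → ℤ) → (Fin d → ℤ) → ℝ)
    {Ω : Type*} [MeasurableSpace Ω] (P : Measure Ω) (X : ℝ≥0 → Ω → (Fin d → ℤ)) : Prop where
  measurable : ∀ t, Measurable (X t)
  start : ∀ᵐ ω ∂P, X 0 ω = 0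
  right_continuous : ∀ᵐ ω ∂P, ∀ t, ContinuousWithinAt (fun s => X s ω) (Set.Ici t) t
  indep_increments : HasIndepIncrements X P
  stationary_increments : ∀ s h, IdentDistrib (X (s + h) - X s) (X h) P P
  rates : ∀ y : Fin d → ℤ,
    Tendsto (fun h : ℝ≥0 => (P.real {ω | X h ω = y} - (if y = 0 then 1 else 0)) / (h : ℝ))
      (𝓝[>] 0) (𝓝 (p 0 y - (if y = 0 then 1 else 0)))

/-- A lattice point as a real vector. -/
def latticeVec {d : ℕ} (x : Fin d → ℤ) : Fin d → ℝ := fun a => (x a : ℝ)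

/-- The Euclidean norm of a lattice point. -/
noncomputable def euclNorm {d : ℕ} (x : Fin d → ℤ) : ℝ := ‖WithLp.toLp 2 (latticeVec x)‖

/-- The covariance matrix `Γ` of one jump: `Γ a b = ∑ z, p(0,z) z_a z_b`. -/
noncomputable def jumpCovariance {d : ℕ} (p : (Fin d → ℤ) → (Fin d → ℤ) → ℝ) :
    Matrix (Fin d) (Fin d) ℝ :=
  Matrix.of fun a b => ∑' z : Fin d → ℤ, p 0 z * (z a : ℝ) * (z b : ℝ)

/-- The density at the lattice point `x` of the centred Gaussian law on `ℝ^d` with covariance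
matrix `t Γ`. -/
noncomputable def gaussianDensity {d : ℕ} (Γ : Matrix (Fin d) (Fin d) ℝ) (t : ℝ)
    (x : Fin d → ℤ) : ℝ :=
  1 / ((2 * Real.pi * t) ^ ((d : ℝ) / 2) * Real.sqrt Γ.det) *
    Real.exp (-(latticeVec x ⬝ᵥ (Γ⁻¹ *ᵥ latticeVec x)) / (2 * t))

/-! The proof compares two Fourier integrals. Stationary independent increments make the
characteristic function of the walk multiplicative in time, and the rates give its derivative at
time zero, so it equals `exp (-t ψ(θ))` with `ψ(θ) = ∑ z, p(0,z) (1 - cos (θ·z))`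
(`integral_latticeChar`). Inversion on `(-π, π]^d` recovers `(2π)^d P(X_t = x)`, while `(2π)^d`
times the Gaussian density is the integral over all of `ℝ^d` with `q(θ) = θ·Γθ/2` in place of `ψ`.

Irreducibility gives `ψ ≥ c‖θ‖²` on the box and `q ≥ c‖θ‖²` everywhere. Since `|ψ - q| ≤ K‖θ‖³`, for
`t ≥ 1` the integrands differ by at most a constant times `t‖θ‖³ exp (-c t‖θ‖²)`, also outside the
box. Rescaling `θ` by `√t` gives an additive error `O(t^(-(d+1)/2))`, uniform in `x`.

For `|x| ≤ M√t` the Gaussian density is at least `B t^(-d/2)`, and division gives the ratio estimate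
for `t ≥ 1`. For `t < 1` the ratio is at most `1/B`, which suffices because `1/√t > 1`. -/

/-- The character `z ↦ exp (i θ·z)` of the lattice `ℤ^d`. -/
noncomputable def latticeChar {d : ℕ} (θ : Fin d → ℝ) (z : Fin d → ℤ) : ℂ :=
  Complex.exp ((θ ⬝ᵥ latticeVec z : ℝ) * Complex.I)

/-! ### Characters of the lattice. -/

section LatticeChar

variable {d : ℕ} (θ : Fin d → ℝ)

@[simp]
lemma latticeVec_zero : latticeVec (0 : Fin d → ℤ) = 0 := by
  ext; simp [latticeVec]

lemma latticeVec_add (x y : Fin d → ℤ) : latticeVec (x + y) = latticeVec x + latticeVec y := by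
  ext; simp [latticeVec]

lemma latticeVec_neg (x : Fin d → ℤ) : latticeVec (-x) = -latticeVec x := by
  ext; simp [latticeVec]

@[simp]
lemma latticeChar_zero : latticeChar θ 0 = 1 := by
  simp [latticeChar]

lemma latticeChar_add (x y : Fin d → ℤ) :
    latticeChar θ (x + y) = latticeChar θ x * latticeChar θ y := by
  rw [latticeChar, latticeVec_add, dotProduct_add, latticeChar, latticeChar, ← Complex.exp_add]
  push_cast
  ring_nf

@[simp]
lemma norm_latticeChar (z : Fin d → ℤ) : ‖latticeChar θ z‖ = 1 :=
  Complex.norm_exp_ofReal_mul_I _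

lemma measurable_latticeChar : Measurable (latticeChar θ) := Measurable.of_discrete

lemma integrable_latticeChar {Ω : Type*} [MeasurableSpace Ω] (P : Measure Ω)
    [IsFiniteMeasure P] {Y : Ω → Fin d → ℤ} (hY : Measurable Y) :
    Integrable (fun ω => latticeChar θ (Y ω)) P :=
  Integrable.of_bound ((measurable_latticeChar θ).comp hY).aestronglyMeasurable 1 (by simp)

end LatticeChar

/-! ### Fourier transform of one jump. -/

section JumpKernel

variable {d : ℕ} {p : (Fin d → ℤ) → (Fin d → ℤ) → ℝ}

/-- A finite range kernel is supported on a finite set of jumps containing `0` and stable under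
negation. -/
lemma IsJumpKernel.exists_support (hp : IsJumpKernel p) :
    ∃ S : Finset (Fin d → ℤ), 0 ∈ S ∧ (∀ z, -z ∈ S ↔ z ∈ S) ∧ ∀ z ∉ S, p 0 z = 0 := by
  obtain ⟨R, hR, h⟩ := hp.finite_range
  refine ⟨(Metric.finite_isBounded_inter_isClosed (s := Set.univ) (K := Metric.closedBall 0 R)
    (isDiscrete_univ_iff.2 inferInstance)
    Metric.isBounded_closedBall isClosed_univ).toFinset, ?_, ?_, ?_⟩
  · simp [hR.le]
  · simp
  · intro z hz
    apply h
    simpa [dist_comm] using hz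

lemma IsJumpKernel.apply_neg (hp : IsJumpKernel p) (z : Fin d → ℤ) : p 0 (-z) = p 0 z := by
  rw [hp.symm 0 z, hp.translation z 0, zero_sub]

lemma IsJumpKernel.sum_eq_one (hp : IsJumpKernel p) {S : Finset (Fin d → ℤ)}
    (hS : ∀ z ∉ S, p 0 z = 0) : ∑ z ∈ S, p 0 z = 1 :=
  (hasSum_sum_of_ne_finset_zero hS).unique (hp.sum_one 0)

/-- The average of `f (θ·z)` over the jump distribution. -/
noncomputable def jumpAverage (S : Finset (Fin d → ℤ)) (p : (Fin d → ℤ) → (Fin d → ℤ) → ℝ)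
    (f : ℝ → ℝ) (θ : Fin d → ℝ) : ℝ :=
  ∑ z ∈ S, p 0 z * f (θ ⬝ᵥ latticeVec z)

/-- The characteristic exponent `∑ z, p(0,z) (1 - cos (θ·z))` of the walk. -/
noncomputable def jumpExponent (S : Finset (Fin d → ℤ)) (p : (Fin d → ℤ) → (Fin d → ℤ) → ℝ)
    (θ : Fin d → ℝ) : ℝ :=
  jumpAverage S p (fun u => 1 - Real.cos u) θ

/-- Symmetry of the jump law cancels the sine terms, so the transform is real. -/
lemma IsJumpKernel.sum_mul_latticeChar (hp : IsJumpKernel p) {S : Finset (Fin d → ℤ)}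
    (hneg : ∀ z, -z ∈ S ↔ z ∈ S) (hS : ∀ z ∉ S, p 0 z = 0) (θ : Fin d → ℝ) :
    ∑ z ∈ S, (p 0 z : ℂ) * latticeChar θ z = 1 - jumpExponent S p θ := by
  have hsin : ∑ z ∈ S, p 0 z * Real.sin (θ ⬝ᵥ latticeVec z) = 0 := by
    have h : ∑ z ∈ S, p 0 z * Real.sin (θ ⬝ᵥ latticeVec z)
        = ∑ z ∈ S, -(p 0 z * Real.sin (θ ⬝ᵥ latticeVec z)) := by
      refine Finset.sum_equiv (Equiv.neg _) (fun z => by simp [hneg]) fun z _ => ?_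
      simp [hp.apply_neg, latticeVec_neg]
    rw [Finset.sum_neg_distrib] at h
    linarith
  have hone := hp.sum_eq_one hS
  have key : ∀ z, (p 0 z : ℂ) * latticeChar θ z
      = ((p 0 z - p 0 z * (1 - Real.cos (θ ⬝ᵥ latticeVec z)) : ℝ) : ℂ)
        + ((p 0 z * Real.sin (θ ⬝ᵥ latticeVec z) : ℝ) : ℂ) * Complex.I := by
    intro z
    rw [latticeChar, Complex.exp_mul_I, ← Complex.ofReal_cos, ← Complex.ofReal_sin]
    push_cast
    ring
  simp_rw [key]
  rw [Finset.sum_add_distrib, ← Finset.sum_mul, ← Complex.ofReal_sum, ← Complex.ofReal_sum, hsin,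
    Finset.sum_sub_distrib, hone, jumpExponent, jumpAverage]
  simp

end JumpKernel

/-! ### Characteristic function of the walk. -/

section Walk

variable {d : ℕ} {p : (Fin d → ℤ) → (Fin d → ℤ) → ℝ} {Ω : Type*} [MeasurableSpace Ω]
  {P : Measure Ω} [IsProbabilityMeasure P] {X : ℝ≥0 → Ω → (Fin d → ℤ)}

-- Almost surely `X (s + t)` is the sum of the increments over `[0, s]` and `[s, s + t]`:
-- independence factorises the expectation and stationarity identifies the second factor.
omit [IsProbabilityMeasure P] in
lemma IsContinuousTimeRandomWalk.integral_latticeChar_add (hX : IsContinuousTimeRandomWalk p P X)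
    (θ : Fin d → ℝ) (s t : ℝ≥0) :
    ∫ ω, latticeChar θ (X (s + t) ω) ∂P
      = (∫ ω, latticeChar θ (X s ω) ∂P) * ∫ ω, latticeChar θ (X t ω) ∂P := by
  have hind : IndepFun (X s - X 0) (X (s + t) - X s) P :=
    hX.indep_increments.indepFun_sub_sub zero_le (le_self_add)
  have hm := hX.measurable
  have h1 : ∫ ω, latticeChar θ (X (s + t) ω) ∂P
      = ∫ ω, latticeChar θ ((X s - X 0) ω) * latticeChar θ ((X (s + t) - X s) ω) ∂P := by
    refine integral_congr_ae ?_
    filter_upwards [hX.start] with ω hω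
    rw [← latticeChar_add]
    simp [hω]
  have h2 : ∫ ω, latticeChar θ ((X s - X 0) ω) ∂P = ∫ ω, latticeChar θ (X s ω) ∂P := by
    refine integral_congr_ae ?_
    filter_upwards [hX.start] with ω hω
    simp [hω]
  have h3 : ∫ ω, latticeChar θ ((X (s + t) - X s) ω) ∂P = ∫ ω, latticeChar θ (X t ω) ∂P :=
    ((hX.stationary_increments s t).comp (measurable_latticeChar θ)).integral_eq
  rw [h1, hind.integral_fun_comp_mul_comp ((hm s).sub (hm 0)).aemeasurable
    ((hm _).sub (hm s)).aemeasurable (measurable_latticeChar θ).aestronglyMeasurable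
    (measurable_latticeChar θ).aestronglyMeasurable, h2, h3]

lemma IsContinuousTimeRandomWalk.integral_latticeChar_nsmul
    (hX : IsContinuousTimeRandomWalk p P X) (θ : Fin d → ℝ) (t : ℝ≥0) (n : ℕ) :
    ∫ ω, latticeChar θ (X (n • t) ω) ∂P = (∫ ω, latticeChar θ (X t ω) ∂P) ^ n := by
  induction n with
  | zero =>
    rw [pow_zero, zero_smul]
    have : ∫ ω, latticeChar θ (X 0 ω) ∂P = ∫ _, (1 : ℂ) ∂P := by
      refine integral_congr_ae ?_
      filter_upwards [hX.start] with ω hω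
      simp [hω]
    simp [this]
  | succ n ih => rw [succ_nsmul, hX.integral_latticeChar_add, ih, pow_succ]

/-- A bounded function of a lattice valued variable is averaged over a finite set `S` up to the
probability of leaving `S`. -/
lemma norm_integral_latticeChar_sub_sum_le {Y : Ω → Fin d → ℤ} (hY : Measurable Y)
    (S : Finset (Fin d → ℤ)) (θ : Fin d → ℝ) :
    ‖∫ ω, latticeChar θ (Y ω) ∂P - ∑ y ∈ S, (P.real {ω | Y ω = y} : ℂ) * latticeChar θ y‖
      ≤ 1 - ∑ y ∈ S, P.real {ω | Y ω = y} := by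
  have hms : ∀ y, MeasurableSet {ω | Y ω = y} := fun y => hY (measurableSet_singleton y)
  have hI : ∀ (c : ℂ) (y : Fin d → ℤ),
      Integrable ({ω | Y ω = y}.indicator fun _ => c) P :=
    fun c y => (integrable_const c).indicator (hms y)
  have hIr : ∀ (c : ℝ) (y : Fin d → ℤ),
      Integrable ({ω | Y ω = y}.indicator fun _ => c) P :=
    fun c y => (integrable_const c).indicator (hms y)
  have h1 : ∑ y ∈ S, (P.real {ω | Y ω = y} : ℂ) * latticeChar θ y
      = ∫ ω, ∑ y ∈ S, ({ω | Y ω = y}.indicator (fun _ => latticeChar θ y) ω) ∂P := by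
    rw [integral_finsetSum _ fun y _ => hI _ y]
    refine Finset.sum_congr rfl fun y _ => ?_
    rw [integral_indicator_const _ (hms y), Complex.real_smul]
  have h2 : 1 - ∑ y ∈ S, P.real {ω | Y ω = y}
      = ∫ ω, (1 - ∑ y ∈ S, ({ω | Y ω = y}.indicator (fun _ => (1 : ℝ)) ω)) ∂P := by
    rw [integral_sub (integrable_const _) (integrable_finsetSum _ fun y _ => hIr _ y),
      integral_finsetSum _ fun y _ => hIr _ y]
    simp [integral_indicator_const _ (hms _)]
  rw [h1, ← integral_sub (integrable_latticeChar θ P hY) (integrable_finsetSum _ fun y _ => hI _ y),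
    h2]
  refine norm_integral_le_of_norm_le
    ((integrable_const _).sub (integrable_finsetSum _ fun y _ => hIr _ y)) (ae_of_all _ fun ω => ?_)
  by_cases h : Y ω ∈ S <;> simp [Set.indicator_apply, h]

lemma IsContinuousTimeRandomWalk.tendsto_integral_latticeChar
    (hX : IsContinuousTimeRandomWalk p P X) (hp : IsJumpKernel p) {S : Finset (Fin d → ℤ)}
    (h0 : 0 ∈ S) (hneg : ∀ z, -z ∈ S ↔ z ∈ S) (hS : ∀ z ∉ S, p 0 z = 0) (θ : Fin d → ℝ) :
    Tendsto (fun h : ℝ≥0 => (∫ ω, latticeChar θ (X h ω) ∂P - 1) / ((h : ℝ) : ℂ)) (𝓝[>] 0)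
      (𝓝 (-(jumpExponent S p θ : ℂ))) := by
  set r : (Fin d → ℤ) → ℝ≥0 → ℝ := fun y h =>
    (P.real {ω | X h ω = y} - (if y = 0 then 1 else 0)) / (h : ℝ) with hr
  have hsumδ : ∑ y ∈ S, (if y = 0 then (1 : ℝ) else 0) = 1 := by simp [h0]
  -- The limits in `rates` are pointwise in `y`. Summed over the finite set `S` they show that the
  -- probability of lying outside `S` is `o(h)`, so no uniformity in `y` is needed.
  have hmass : Tendsto (fun h => -∑ y ∈ S, r y h) (𝓝[>] 0) (𝓝 0) := by
    have := (tendsto_finsetSum S fun y _ => hX.rates y).neg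
    rwa [Finset.sum_sub_distrib, hsumδ, hp.sum_eq_one hS, sub_self, neg_zero] at this
  have hmain : Tendsto (fun h => ∑ y ∈ S, (r y h : ℂ) * latticeChar θ y) (𝓝[>] 0)
      (𝓝 (-(jumpExponent S p θ : ℂ))) := by
    have := tendsto_finsetSum S fun y _ =>
      ((Complex.continuous_ofReal.tendsto _).comp (hX.rates y)).mul_const (latticeChar θ y)
    convert this using 2
    · rfl
    have e : ∀ y, ((p 0 y - (if y = 0 then 1 else 0) : ℝ) : ℂ) * latticeChar θ y
        = (p 0 y : ℂ) * latticeChar θ y - if y = 0 then 1 else 0 := by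
      intro y
      split_ifs with hy
      · subst hy; simp
      · simp
    simp_rw [e]
    rw [Finset.sum_sub_distrib, hp.sum_mul_latticeChar hneg hS]
    simp [h0]
  have herr : Tendsto (fun h : ℝ≥0 => (∫ ω, latticeChar θ (X h ω) ∂P - 1) / ((h : ℝ) : ℂ)
      - ∑ y ∈ S, (r y h : ℂ) * latticeChar θ y) (𝓝[>] 0) (𝓝 0) := by
    refine squeeze_zero_norm' ?_ hmass
    filter_upwards [self_mem_nhdsWithin] with h hh
    have hh' : (0 : ℝ) < h := hh
    have hb := norm_integral_latticeChar_sub_sum_le (P := P) (hX.measurable h) S θ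
    have e1 : (∫ ω, latticeChar θ (X h ω) ∂P - 1) / ((h : ℝ) : ℂ)
        - ∑ y ∈ S, (r y h : ℂ) * latticeChar θ y
        = (∫ ω, latticeChar θ (X h ω) ∂P
          - ∑ y ∈ S, (P.real {ω | X h ω = y} : ℂ) * latticeChar θ y) / ((h : ℝ) : ℂ) := by
      have e : ∀ y, (r y h : ℂ) * latticeChar θ y
          = ((P.real {ω | X h ω = y} : ℂ) * latticeChar θ y - if y = 0 then 1 else 0)
            / ((h : ℝ) : ℂ) := by
        intro y
        simp only [hr]
        split_ifs with hy
        · subst hy; simp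
        · simp; ring
      simp_rw [e]
      rw [← Finset.sum_div, Finset.sum_sub_distrib]
      simp only [Finset.sum_ite_eq', h0, if_true]
      ring
    have e2 : -∑ y ∈ S, r y h = (1 - ∑ y ∈ S, P.real {ω | X h ω = y}) / h := by
      simp only [hr]
      rw [← Finset.sum_div, Finset.sum_sub_distrib, hsumδ]
      ring
    rw [e1, e2, norm_div, Complex.norm_real, Real.norm_of_nonneg hh'.le]
    gcongr
  simpa using herr.add hmain

/-- The characteristic function of the walk at time `t`. -/
theorem IsContinuousTimeRandomWalk.integral_latticeChar
    (hX : IsContinuousTimeRandomWalk p P X) (hp : IsJumpKernel p) {S : Finset (Fin d → ℤ)}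
    (h0 : 0 ∈ S) (hneg : ∀ z, -z ∈ S ↔ z ∈ S) (hS : ∀ z ∉ S, p 0 z = 0) {t : ℝ≥0} (ht : 0 < t)
    (θ : Fin d → ℝ) :
    ∫ ω, latticeChar θ (X t ω) ∂P = (Real.exp (-(t * jumpExponent S p θ)) : ℝ) := by
  have ht' : (0 : ℝ) < t := ht
  -- With `φ` the characteristic function, `φ_t = φ_{t/n} ^ n` and `n (φ_{t/n} - 1) → -t ψ(θ)`, so
  -- the powers converge to the exponential.
  have hseq : Tendsto (fun n : ℕ => t / (n : ℝ≥0)) atTop (𝓝[>] 0) := by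
    refine tendsto_nhdsWithin_iff.2 ⟨?_, ?_⟩
    · rw [← NNReal.tendsto_coe]
      simpa using tendsto_const_div_atTop_nhds_zero_nat (t : ℝ)
    · filter_upwards [eventually_gt_atTop 0] with n hn
      exact div_pos ht (by exact_mod_cast hn)
  have hlim := ((hX.tendsto_integral_latticeChar hp h0 hneg hS θ).comp hseq).const_mul
    ((t : ℝ) : ℂ)
  have hexp := Complex.tendsto_one_add_pow_exp_of_tendsto
    (g := fun n : ℕ => ∫ ω, latticeChar θ (X (t / (n : ℝ≥0)) ω) ∂P - 1) (hlim.congr' ?_)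
  · refine tendsto_nhds_unique (tendsto_const_nhds.congr' ?_) (hexp.trans (by simp))
    filter_upwards [eventually_gt_atTop 0] with n hn
    have hn' : (n : ℝ≥0) ≠ 0 := by exact_mod_cast hn.ne'
    rw [add_sub_cancel, ← hX.integral_latticeChar_nsmul, nsmul_eq_mul, mul_div_cancel₀ _ hn']
  · filter_upwards [eventually_gt_atTop 0] with n hn
    have hn' : (n : ℂ) ≠ 0 := by exact_mod_cast hn.ne'
    have : ((t : ℝ) : ℂ) ≠ 0 := by exact_mod_cast ht'.ne'
    simp only [Function.comp_apply, NNReal.coe_div, NNReal.coe_natCast, Complex.ofReal_div,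
      Complex.ofReal_natCast]
    field_simp

end Walk

/-! ### Orthogonality of characters and Fourier inversion. -/

section Torus

/-- The fundamental domain `(-π, π]^d` of the dual torus of `ℤ^d`. -/
def torusBox (d : ℕ) : Set (Fin d → ℝ) := Set.univ.pi fun _ => Set.Ioc (-Real.pi) Real.pi

lemma measurableSet_torusBox (d : ℕ) : MeasurableSet (torusBox d) :=
  MeasurableSet.univ_pi fun _ => measurableSet_Ioc

lemma volume_torusBox_lt_top (d : ℕ) : volume (torusBox d) < ⊤ := by
  rw [torusBox, volume_pi_pi]
  exact ENNReal.prod_lt_top fun _ _ => by simp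

lemma integral_exp_int_mul (k : ℤ) :
    ∫ u in Set.Ioc (-Real.pi) Real.pi, Complex.exp ((u * (k : ℝ) : ℝ) * Complex.I)
      = if k = 0 then (2 * Real.pi : ℂ) else 0 := by
  rw [← intervalIntegral.integral_of_le (by linarith [Real.pi_pos])]
  split_ifs with hk
  · subst hk
    simp
    ring
  · have hc : (k : ℂ) * Complex.I ≠ 0 := by simp [hk]
    have e : ∀ u : ℝ, ((u * (k : ℝ) : ℝ) : ℂ) * Complex.I = (k : ℂ) * Complex.I * (u : ℂ) := by
      intro u; push_cast; ring
    simp_rw [e]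
    rw [integral_exp_mul_complex hc]
    have : Complex.exp ((k : ℂ) * Complex.I * (Real.pi : ℂ))
        = Complex.exp ((k : ℂ) * Complex.I * ((-Real.pi : ℝ) : ℂ)) :=
      Complex.exp_eq_exp_iff_exists_int.2 ⟨k, by push_cast; ring⟩
    rw [this, sub_self, zero_div]

lemma setIntegral_latticeChar {d : ℕ} (z : Fin d → ℤ) :
    ∫ θ in torusBox d, latticeChar θ z = if z = 0 then (2 * Real.pi : ℂ) ^ d else 0 := by
  have e : ∀ θ : Fin d → ℝ, latticeChar θ z
      = ∏ a, Complex.exp ((θ a * (z a : ℝ) : ℝ) * Complex.I) := by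
    intro θ
    rw [latticeChar, ← Complex.exp_sum, ← Finset.sum_mul, ← Complex.ofReal_sum]
    rfl
  simp_rw [e]
  rw [torusBox, volume_pi, Measure.restrict_pi_pi,
    integral_fintype_prod_eq_prod
      (fun (a : Fin d) (u : ℝ) => Complex.exp ((u * (z a : ℝ) : ℝ) * Complex.I))]
  simp_rw [integral_exp_int_mul]
  split_ifs with hz
  · subst hz; simp
  · obtain ⟨a, ha⟩ := Function.ne_iff.1 hz
    exact Finset.prod_eq_zero (Finset.mem_univ a) (if_neg ha)

lemma continuous_latticeChar_left {d : ℕ} (z : Fin d → ℤ) :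
    Continuous fun θ : Fin d → ℝ => latticeChar θ z := by
  unfold latticeChar
  fun_prop

/-- Fourier inversion for lattice valued random variables. -/
theorem setIntegral_latticeChar_mul_integral {d : ℕ} {Ω : Type*} [MeasurableSpace Ω]
    (P : Measure Ω) [IsProbabilityMeasure P] {Y : Ω → Fin d → ℤ} (hY : Measurable Y)
    (x : Fin d → ℤ) :
    ∫ θ in torusBox d, latticeChar θ (-x) * ∫ ω, latticeChar θ (Y ω) ∂P
      = (2 * Real.pi : ℂ) ^ d * (P.real {ω | Y ω = x} : ℂ) := by
  have : IsFiniteMeasure (volume.restrict (torusBox d)) :=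
    ⟨by simpa using volume_torusBox_lt_top d⟩
  have hmeas : Measurable (fun q : (Fin d → ℝ) × Ω => latticeChar q.1 (Y q.2 - x)) := by
    have h : Measurable (fun q : (Fin d → ℝ) × Ω => latticeVec (Y q.2 - x)) :=
      (Measurable.of_discrete (f := fun y : Fin d → ℤ => latticeVec (y - x))).comp
        (hY.comp measurable_snd)
    have h' : Measurable (fun q : (Fin d → ℝ) × Ω => q.1 ⬝ᵥ latticeVec (Y q.2 - x)) := by
      unfold dotProduct
      exact Finset.measurable_fun_sum _ fun a _ =>
        ((measurable_pi_apply a).comp measurable_fst).mul ((measurable_pi_apply a).comp h)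
    unfold latticeChar
    fun_prop
  have hint : Integrable (Function.uncurry fun (θ : Fin d → ℝ) ω => latticeChar θ (Y ω - x))
      ((volume.restrict (torusBox d)).prod P) :=
    Integrable.of_bound hmeas.aestronglyMeasurable 1
      (ae_of_all _ fun q => (norm_latticeChar q.1 (Y q.2 - x)).le)
  have e : ∀ θ : Fin d → ℝ, latticeChar θ (-x) * ∫ ω, latticeChar θ (Y ω) ∂P
      = ∫ ω, latticeChar θ (Y ω - x) ∂P := by
    intro θ
    rw [← integral_const_mul]
    simp_rw [sub_eq_neg_add, latticeChar_add]
  simp_rw [e]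
  rw [integral_integral_swap hint]
  simp_rw [setIntegral_latticeChar, sub_eq_zero]
  have hi : (fun ω => if Y ω = x then (2 * Real.pi : ℂ) ^ d else 0)
      = {ω | Y ω = x}.indicator fun _ => (2 * Real.pi : ℂ) ^ d := by
    ext ω; simp [Set.indicator_apply]
  have hms : MeasurableSet {ω | Y ω = x} := hY (measurableSet_singleton x)
  rw [hi, integral_indicator_const _ hms, Complex.real_smul, mul_comm]

end Torus

/-! ### The Gaussian density as a Fourier integral. -/

section Gaussian

open scoped MatrixOrder

/-- The symmetric square root of `Γ` is the change of variables that makes the Gaussian integral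
isotropic; its determinant is the factor `√det Γ` of the density. -/
lemma Matrix.PosDef.exists_isSymm_mul_self {n : Type*} [Fintype n] [DecidableEq n]
    {A : Matrix n n ℝ} (hA : A.PosDef) :
    ∃ B : Matrix n n ℝ, Bᵀ = B ∧ B * B = A ∧ 0 < B.det ∧ B.det = Real.sqrt A.det := by
  have h0 := Matrix.nonneg_iff_posSemidef.2 hA.posSemidef
  have hdet : (CFC.sqrt A).det = Real.sqrt A.det := by
    rw [hA.posSemidef.det_sqrt]
    simp [RCLike.sqrt_of_nonneg hA.det_pos.le]
  refine ⟨CFC.sqrt A, ?_, CFC.sqrt_mul_sqrt_self A h0, ?_, hdet⟩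
  · have := (Matrix.nonneg_iff_posSemidef.1 (CFC.sqrt_nonneg A)).isHermitian
    simpa [Matrix.IsHermitian, Matrix.conjTranspose_eq_transpose_of_trivial] using this
  · rw [hdet]
    exact Real.sqrt_pos.2 hA.det_pos

/-- The Gaussian density as an inverse Fourier transform. -/
theorem integral_latticeChar_mul_gaussian {d : ℕ} {Γ : Matrix (Fin d) (Fin d) ℝ} (hΓ : Γ.PosDef)
    {t : ℝ} (ht : 0 < t) (x : Fin d → ℤ) :
    ∫ θ : Fin d → ℝ, latticeChar θ (-x) * (Real.exp (-(t * (θ ⬝ᵥ (Γ *ᵥ θ) / 2))) : ℝ)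
      = (2 * Real.pi : ℂ) ^ d * (gaussianDensity Γ t x : ℂ) := by
  obtain ⟨B, hB, hBB, hpos, hdet⟩ := hΓ.exists_isSymm_mul_self
  have hunit : IsUnit B.det := hpos.ne'.isUnit
  -- This choice gives `θ·x = y·(Bθ)` and `y·y = x·Γ⁻¹x`, so under `v = Bθ` both the phase and the
  -- quadratic form become standard.
  set y : Fin d → ℝ := B⁻¹ *ᵥ latticeVec x with hy
  have hBinvT : (B⁻¹)ᵀ = B⁻¹ := by rw [Matrix.transpose_nonsing_inv, hB]
  have hyy : y ⬝ᵥ y = latticeVec x ⬝ᵥ (Γ⁻¹ *ᵥ latticeVec x) := by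
    rw [hy, Matrix.dotProduct_mulVec, Matrix.vecMul_mulVec, hBinvT, ← Matrix.mul_inv_rev,
      hBB, Matrix.dotProduct_mulVec]
  have hlin : ∀ θ : Fin d → ℝ, θ ⬝ᵥ latticeVec x = y ⬝ᵥ (B *ᵥ θ) := by
    intro θ
    rw [hy, Matrix.dotProduct_mulVec, Matrix.vecMul_mulVec, hBinvT, Matrix.nonsing_inv_mul _ hunit,
      Matrix.vecMul_one, dotProduct_comm]
  have hquad : ∀ θ : Fin d → ℝ, θ ⬝ᵥ (Γ *ᵥ θ) = (B *ᵥ θ) ⬝ᵥ (B *ᵥ θ) := by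
    intro θ
    rw [Matrix.dotProduct_mulVec (B *ᵥ θ), Matrix.vecMul_mulVec, hB, hBB, Matrix.dotProduct_mulVec]
  set g : (Fin d → ℝ) → ℂ := fun v =>
    Complex.exp (-((t / 2 : ℝ) : ℂ) * ∑ i, (v i : ℂ) ^ 2 + ∑ i, (-Complex.I * (y i : ℂ)) * v i)
    with hg
  have hgc : Continuous g := by rw [hg]; fun_prop
  have e : ∀ θ : Fin d → ℝ,
      latticeChar θ (-x) * (Real.exp (-(t * (θ ⬝ᵥ (Γ *ᵥ θ) / 2))) : ℝ)
        = g (Matrix.toLin' B θ) := by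
    intro θ
    rw [latticeChar, latticeVec_neg, dotProduct_neg, hlin, hquad, Complex.ofReal_exp,
      ← Complex.exp_add, hg]
    simp only [Matrix.toLin'_apply]
    congr 1
    generalize B *ᵥ θ = v
    simp only [dotProduct]
    push_cast
    simp_rw [mul_assoc, ← Finset.mul_sum, ← pow_two]
    ring
  have hmap := Real.map_matrix_volume_pi_eq_smul_volume_pi hpos.ne'
  have hchange : ∫ θ, g (Matrix.toLin' B θ) = (|B.det⁻¹| : ℝ) • ∫ v, g v := by
    have := integral_map (μ := volume) (φ := Matrix.toLin' B) (f := g)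
      (LinearMap.continuous_of_finiteDimensional _).measurable.aemeasurable
      hgc.aestronglyMeasurable
    rw [← this, hmap, integral_smul_measure, ENNReal.toReal_ofReal (abs_nonneg _)]
  simp_rw [e]
  rw [hchange, hg, GaussianFourier.integral_cexp_neg_mul_sum_add
    (by rw [Complex.ofReal_re]; positivity)]
  have hsq : ∑ i, (-Complex.I * (y i : ℂ)) ^ 2 = ((-(y ⬝ᵥ y) : ℝ) : ℂ) := by
    simp only [mul_pow, neg_sq, Complex.I_sq, dotProduct]
    push_cast
    rw [← Finset.mul_sum]
    simp_rw [← pow_two]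
    ring
  rw [hsq, hyy, gaussianDensity, Complex.real_smul, ← hdet, abs_of_pos (inv_pos.2 hpos)]
  have hpow : ((Real.pi : ℂ) / ((t / 2 : ℝ) : ℂ)) ^ ((Fintype.card (Fin d) : ℂ) / 2)
      = (((2 * Real.pi) ^ d / (2 * Real.pi * t) ^ ((d : ℝ) / 2) : ℝ) : ℂ) := by
    have h1 : (Real.pi / (t / 2)) ^ ((d : ℝ) / 2)
        = (2 * Real.pi) ^ d / (2 * Real.pi * t) ^ ((d : ℝ) / 2) := by
      rw [eq_div_iff (by positivity), ← Real.mul_rpow (by positivity) (by positivity)]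
      have : Real.pi / (t / 2) * (2 * Real.pi * t) = (2 * Real.pi) ^ (2 : ℝ) := by
        rw [Real.rpow_two]; field_simp
      rw [this, ← Real.rpow_mul (by positivity), ← Real.rpow_natCast]
      congr 1
      ring
    rw [← h1, Complex.ofReal_cpow (by positivity)]
    push_cast
    simp
  have hexp : Complex.exp (((-(latticeVec x ⬝ᵥ (Γ⁻¹ *ᵥ latticeVec x)) : ℝ) : ℂ)
        / (4 * ((t / 2 : ℝ) : ℂ)))
      = ((Real.exp (-(latticeVec x ⬝ᵥ (Γ⁻¹ *ᵥ latticeVec x)) / (2 * t)) : ℝ) : ℂ) := by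
    rw [Complex.ofReal_exp]
    congr 1
    push_cast
    ring_nf
  rw [hpow, hexp]
  push_cast
  ring

end Gaussian

/-! ### Quadratic lower bounds and expansion of the exponent. -/

section Coercivity

variable {d : ℕ} {p : (Fin d → ℤ) → (Fin d → ℤ) → ℝ} {S : Finset (Fin d → ℤ)}

/-- By irreducibility, a nonnegative function with `f (a + b) ≤ 2 f a + 2 f b` is controlled in
every lattice direction by its average over the jumps. -/
lemma IsJumpKernel.exists_le_mul_jumpAverage (hp : IsJumpKernel p) (hS : ∀ z ∉ S, p 0 z = 0)
    {f : ℝ → ℝ} (hf0 : f 0 = 0) (hf : ∀ u, 0 ≤ f u)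
    (hadd : ∀ u v, f (u + v) ≤ 2 * f u + 2 * f v) (y : Fin d → ℤ) :
    ∃ C : ℝ, 0 ≤ C ∧ ∀ θ : Fin d → ℝ, f (θ ⬝ᵥ latticeVec y) ≤ C * jumpAverage S p f θ := by
  induction hp.irreducible 0 y with
  | refl => exact ⟨0, le_rfl, fun θ => by simp [hf0]⟩
  | @tail i j _ hij ih =>
    obtain ⟨C, hC, h⟩ := ih
    rw [hp.translation] at hij
    -- Split off the last jump of the path: one term of the average controls `f` on that jump, and
    -- `hadd` costs a factor 2.
    refine ⟨2 * C + 2 * (p 0 (j - i))⁻¹, by positivity, fun θ => ?_⟩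
    have hmem : j - i ∈ S := by
      by_contra hn
      exact hij.ne' (hS _ hn)
    have hle : p 0 (j - i) * f (θ ⬝ᵥ latticeVec (j - i)) ≤ jumpAverage S p f θ :=
      Finset.single_le_sum (f := fun z => p 0 z * f (θ ⬝ᵥ latticeVec z))
        (fun z _ => mul_nonneg (hp.nonneg 0 z) (hf _)) hmem
    have hle' : f (θ ⬝ᵥ latticeVec (j - i)) ≤ (p 0 (j - i))⁻¹ * jumpAverage S p f θ := by
      rwa [inv_mul_eq_div, le_div_iff₀' hij]
    have hsplit : θ ⬝ᵥ latticeVec j = θ ⬝ᵥ latticeVec i + θ ⬝ᵥ latticeVec (j - i) := by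
      rw [← dotProduct_add, ← latticeVec_add, add_sub_cancel]
    rw [hsplit]
    linarith [hadd (θ ⬝ᵥ latticeVec i) (θ ⬝ᵥ latticeVec (j - i)), h θ]

lemma jumpAverage_nonneg (hp : IsJumpKernel p) {f : ℝ → ℝ} (hf : ∀ u, 0 ≤ f u)
    (θ : Fin d → ℝ) : 0 ≤ jumpAverage S p f θ :=
  Finset.sum_nonneg fun z _ => mul_nonneg (hp.nonneg 0 z) (hf _)

/-- Apply the path bound to the unit vectors. The choice `f u = u ^ 2` yields coercivity of `Γ`, and
`f u = 1 - cos u` that of the exponent. -/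
lemma IsJumpKernel.exists_forall_coord_le (hp : IsJumpKernel p) (hS : ∀ z ∉ S, p 0 z = 0)
    {f : ℝ → ℝ} (hf0 : f 0 = 0) (hf : ∀ u, 0 ≤ f u)
    (hadd : ∀ u v, f (u + v) ≤ 2 * f u + 2 * f v) :
    ∃ C : ℝ, 0 < C ∧ ∀ (θ : Fin d → ℝ) a, f (θ a) ≤ C * jumpAverage S p f θ := by
  choose C hC h using fun a : Fin d =>
    hp.exists_le_mul_jumpAverage hS hf0 hf hadd (Pi.single a 1)
  have hsum : 0 ≤ ∑ a, C a := Finset.sum_nonneg fun a _ => hC a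
  refine ⟨∑ a, C a + 1, by linarith, fun θ a => ?_⟩
  have hsingle : θ ⬝ᵥ latticeVec (Pi.single a 1) = θ a := by
    have : latticeVec (Pi.single a 1 : Fin d → ℤ) = Pi.single a 1 := by
      ext b
      by_cases hb : b = a
      · subst hb; simp [latticeVec]
      · simp [latticeVec, hb]
    rw [this, dotProduct_single_one]
  have hle : C a ≤ ∑ a, C a + 1 :=
    (Finset.single_le_sum (fun b _ => hC b) (Finset.mem_univ a)).trans (by linarith)
  calc f (θ a) ≤ C a * jumpAverage S p f θ := by rw [← hsingle]; exact h a θ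
    _ ≤ _ := mul_le_mul_of_nonneg_right hle (jumpAverage_nonneg hp hf θ)

lemma norm_sq_le_of_forall_sq_le {θ : Fin d → ℝ} {r : ℝ} (hr : 0 ≤ r) (h : ∀ a, θ a ^ 2 ≤ r) :
    ‖θ‖ ^ 2 ≤ r := by
  have : ‖θ‖ ≤ Real.sqrt r := (pi_norm_le_iff_of_nonneg (Real.sqrt_nonneg r)).2 fun a =>
    Real.abs_le_sqrt (h a)
  exact (Real.le_sqrt (norm_nonneg _) hr).1 this

lemma IsJumpKernel.exists_mul_norm_sq_le_jumpAverage_sq (hp : IsJumpKernel p)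
    (hS : ∀ z ∉ S, p 0 z = 0) :
    ∃ c : ℝ, 0 < c ∧ ∀ θ : Fin d → ℝ, c * ‖θ‖ ^ 2 ≤ jumpAverage S p (fun u => u ^ 2) θ := by
  obtain ⟨C, hC, h⟩ := hp.exists_forall_coord_le hS (f := fun u => u ^ 2) (by simp)
    (fun u => sq_nonneg u) (fun u v => by nlinarith [sq_nonneg (u - v)])
  refine ⟨C⁻¹, by positivity, fun θ => ?_⟩
  rw [inv_mul_eq_div, div_le_iff₀' hC]
  exact norm_sq_le_of_forall_sq_le
    (mul_nonneg hC.le (jumpAverage_nonneg hp (fun u => sq_nonneg u) θ)) (h θ)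

/-- Write `1 - cos u = 2 sin² (u/2)`, expand the sine of the sum and use `(a + b)² ≤ 2a² + 2b²`. -/
lemma one_sub_cos_add_le (u v : ℝ) :
    1 - Real.cos (u + v) ≤ 2 * (1 - Real.cos u) + 2 * (1 - Real.cos v) := by
  have h : ∀ w : ℝ, 1 - Real.cos (2 * w) = 2 * Real.sin w ^ 2 := fun w => by
    rw [Real.cos_two_mul, Real.sin_sq]; ring
  have hu := h (u / 2)
  have hv := h (v / 2)
  have huv := h (u / 2 + v / 2)
  rw [show 2 * (u / 2) = u by ring] at hu
  rw [show 2 * (v / 2) = v by ring] at hv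
  rw [show 2 * (u / 2 + v / 2) = u + v by ring, Real.sin_add] at huv
  rw [hu, hv, huv]
  set a := Real.sin (u / 2) * Real.cos (v / 2)
  set b := Real.cos (u / 2) * Real.sin (v / 2)
  have ha : a ^ 2 ≤ Real.sin (u / 2) ^ 2 := by
    rw [mul_pow]; exact mul_le_of_le_one_right (sq_nonneg _) (Real.cos_sq_le_one _)
  have hb : b ^ 2 ≤ Real.sin (v / 2) ^ 2 := by
    rw [mul_pow]; exact mul_le_of_le_one_left (sq_nonneg _) (Real.cos_sq_le_one _)
  nlinarith [sq_nonneg (a - b)]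

/-- The box is essential, as the exponent is `2π`-periodic in each coordinate. The constant comes
from `1 - cos u ≥ 2u²/π²` for `|u| ≤ π`. -/
lemma IsJumpKernel.exists_mul_norm_sq_le_jumpExponent (hp : IsJumpKernel p)
    (hS : ∀ z ∉ S, p 0 z = 0) :
    ∃ c : ℝ, 0 < c ∧ ∀ θ ∈ torusBox d, c * ‖θ‖ ^ 2 ≤ jumpExponent S p θ := by
  obtain ⟨C, hC, h⟩ := hp.exists_forall_coord_le hS (f := fun u => 1 - Real.cos u) (by simp)
    (fun u => by linarith [Real.cos_le_one u]) one_sub_cos_add_le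
  have hπ := Real.pi_pos
  refine ⟨2 / (Real.pi ^ 2 * C), by positivity, fun θ hθ => ?_⟩
  have hψ : 0 ≤ jumpExponent S p θ :=
    jumpAverage_nonneg hp (fun u => by linarith [Real.cos_le_one u]) θ
  have hkey : ‖θ‖ ^ 2 ≤ Real.pi ^ 2 * C / 2 * jumpExponent S p θ := by
    refine norm_sq_le_of_forall_sq_le (by positivity) fun a => ?_
    have hθa := hθ a (Set.mem_univ a)
    have hcos := Real.cos_le_one_sub_mul_cos_sq (x := θ a) (abs_le.2 ⟨hθa.1.le, hθa.2⟩)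
    have h2 : 2 / Real.pi ^ 2 * θ a ^ 2 ≤ C * jumpExponent S p θ := by
      have := h θ a
      simp only [jumpExponent]
      linarith
    calc θ a ^ 2 = Real.pi ^ 2 / 2 * (2 / Real.pi ^ 2 * θ a ^ 2) := by field_simp
      _ ≤ Real.pi ^ 2 / 2 * (C * jumpExponent S p θ) := by gcongr
      _ = _ := by ring
  calc 2 / (Real.pi ^ 2 * C) * ‖θ‖ ^ 2
      ≤ 2 / (Real.pi ^ 2 * C) * (Real.pi ^ 2 * C / 2 * jumpExponent S p θ) := by gcongr
    _ = jumpExponent S p θ := by field_simp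

/-- For `|u| ≤ 1` the Taylor remainder is quartic; for `|u| ≥ 1` the quantity is at most `u²/2`,
hence below `|u|³`. -/
lemma abs_one_sub_cos_sub_sq_le (u : ℝ) : |1 - Real.cos u - u ^ 2 / 2| ≤ |u| ^ 3 := by
  rcases le_total |u| 1 with h | h
  · have hb := Real.cos_bound h
    have hcube : 0 ≤ |u| ^ 3 := by positivity
    have h4 : |u| ^ 4 ≤ |u| ^ 3 := pow_le_pow_of_le_one (abs_nonneg u) h (by norm_num)
    rw [show 1 - Real.cos u - u ^ 2 / 2 = -(Real.cos u - (1 - u ^ 2 / 2)) by ring, abs_neg]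
    linarith
  · have h1 := Real.one_sub_sq_div_two_le_cos (x := u)
    have h2 := Real.cos_le_one u
    have h3 : |u| ^ 2 ≤ |u| ^ 3 := pow_le_pow_right₀ h (by norm_num)
    rw [sq_abs] at h3
    rw [abs_le]
    constructor <;> nlinarith [sq_nonneg u]

lemma abs_dotProduct_latticeVec_le (θ : Fin d → ℝ) (z : Fin d → ℤ) :
    |θ ⬝ᵥ latticeVec z| ≤ ‖θ‖ * ∑ a, |latticeVec z a| := by
  rw [dotProduct, Finset.mul_sum]
  refine (Finset.abs_sum_le_sum_abs _ _).trans (Finset.sum_le_sum fun a _ => ?_)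
  rw [abs_mul]
  gcongr
  exact norm_le_pi_norm θ a

/-- Second order expansion of the characteristic exponent at the origin. -/
lemma IsJumpKernel.exists_abs_jumpExponent_sub_le (hp : IsJumpKernel p) :
    ∃ K : ℝ, 0 ≤ K ∧ ∀ θ : Fin d → ℝ,
      |jumpExponent S p θ - jumpAverage S p (fun u => u ^ 2) θ / 2| ≤ K * ‖θ‖ ^ 3 := by
  have hnn := hp.nonneg 0
  refine ⟨∑ z ∈ S, p 0 z * (∑ a, |latticeVec z a|) ^ 3,
    Finset.sum_nonneg fun z _ => mul_nonneg (hnn z) (by positivity), fun θ => ?_⟩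
  rw [jumpExponent, jumpAverage, jumpAverage, Finset.sum_div, ← Finset.sum_sub_distrib,
    Finset.sum_mul]
  refine (Finset.abs_sum_le_sum_abs _ _).trans (Finset.sum_le_sum fun z _ => ?_)
  rw [mul_div_assoc, ← mul_sub, abs_mul, abs_of_nonneg (hnn z), mul_assoc, ← mul_pow]
  refine mul_le_mul_of_nonneg_left ((abs_one_sub_cos_sub_sq_le _).trans ?_) (hnn z)
  rw [mul_comm (∑ a, |latticeVec z a|)]
  exact pow_le_pow_left₀ (abs_nonneg _) (abs_dotProduct_latticeVec_le θ z) 3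

lemma dotProduct_jumpCovariance_mulVec (hS : ∀ z ∉ S, p 0 z = 0) (θ : Fin d → ℝ) :
    θ ⬝ᵥ (jumpCovariance p *ᵥ θ) = jumpAverage S p (fun u => u ^ 2) θ := by
  have hΓ : ∀ a b, jumpCovariance p a b = ∑ z ∈ S, p 0 z * (z a : ℝ) * (z b : ℝ) := fun a b =>
    tsum_eq_sum fun z hz => by simp [hS z hz]
  simp only [dotProduct, Matrix.mulVec, jumpAverage, hΓ, latticeVec, pow_two]
  simp_rw [Finset.sum_mul_sum, Finset.mul_sum, Finset.sum_mul, Finset.mul_sum]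
  conv_rhs => rw [Finset.sum_comm]
  refine Finset.sum_congr rfl fun a _ => ?_
  rw [Finset.sum_comm]
  exact Finset.sum_congr rfl fun z _ => Finset.sum_congr rfl fun b _ => by ring

lemma IsJumpKernel.posDef_jumpCovariance (hp : IsJumpKernel p) : (jumpCovariance p).PosDef := by
  obtain ⟨S, -, -, hS⟩ := hp.exists_support
  obtain ⟨c, hc, h⟩ := hp.exists_mul_norm_sq_le_jumpAverage_sq hS
  refine Matrix.PosDef.of_dotProduct_mulVec_pos ?_ fun θ hθ => ?_
  · ext a b
    simp [jumpCovariance, mul_right_comm]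
  · rw [star_trivial, dotProduct_jumpCovariance_mulVec hS]
    have := norm_pos_iff.2 hθ
    exact lt_of_lt_of_le (by positivity) (h θ)

end Coercivity

/-! ### Comparison of the two Fourier integrals. -/

section Estimate

lemma integrable_norm_pow_mul_exp_neg_mul_sq {E : Type*} [NormedAddCommGroup E]
    [NormedSpace ℝ E] [FiniteDimensional ℝ E] [Nontrivial E] [MeasurableSpace E] [BorelSpace E]
    (μ : Measure E) [μ.IsAddHaarMeasure] (n : ℕ) {c : ℝ} (hc : 0 < c) :
    Integrable (fun x : E => ‖x‖ ^ n * Real.exp (-c * ‖x‖ ^ 2)) μ := by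
  rw [integrable_fun_norm_addHaar μ (f := fun y => y ^ n * Real.exp (-c * y ^ 2))]
  refine (integrableOn_rpow_mul_exp_neg_mul_sq hc
    (s := ((Module.finrank ℝ E - 1 + n : ℕ) : ℝ)) ?_).congr_fun (fun y hy => ?_) measurableSet_Ioi
  · have : (0 : ℝ) ≤ ((Module.finrank ℝ E - 1 + n : ℕ) : ℝ) := Nat.cast_nonneg _
    linarith
  · simp only [Real.rpow_natCast, smul_eq_mul, pow_add]
    ring

/-- Follows from `1 - exp (-s) ≤ s`. With `m = c t‖θ‖²` it turns the bound on the exponents into one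
that keeps Gaussian decay. -/
lemma abs_exp_neg_sub_exp_neg_le {a b m : ℝ} (ha : m ≤ a) (hb : m ≤ b) :
    |Real.exp (-a) - Real.exp (-b)| ≤ |a - b| * Real.exp (-m) := by
  wlog h : a ≤ b generalizing a b
  · rw [abs_sub_comm, abs_sub_comm a b]
    exact this hb ha (le_of_not_ge h)
  have h1 : Real.exp (-b) = Real.exp (-a) * Real.exp (-(b - a)) := by
    rw [← Real.exp_add]; ring_nf
  have h2 : 1 - (b - a) ≤ Real.exp (-(b - a)) := by
    linarith [Real.add_one_le_exp (-(b - a))]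
  have h3 : Real.exp (-a) ≤ Real.exp (-m) := Real.exp_le_exp.2 (by linarith)
  have h4 : Real.exp (-b) ≤ Real.exp (-a) := Real.exp_le_exp.2 (by linarith)
  rw [abs_of_nonneg (by linarith), abs_of_nonpos (by linarith), h1]
  calc Real.exp (-a) - Real.exp (-a) * Real.exp (-(b - a))
      = Real.exp (-a) * (1 - Real.exp (-(b - a))) := by ring
    _ ≤ Real.exp (-a) * (b - a) := mul_le_mul_of_nonneg_left (by linarith) (Real.exp_nonneg _)
    _ ≤ Real.exp (-m) * (b - a) := mul_le_mul_of_nonneg_right h3 (by linarith)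
    _ = _ := by ring

lemma one_le_norm_of_notMem_torusBox {d : ℕ} {θ : Fin d → ℝ} (h : θ ∉ torusBox d) : 1 ≤ ‖θ‖ := by
  simp only [torusBox, Set.mem_univ_pi, not_forall] at h
  obtain ⟨a, ha⟩ := h
  refine le_trans ?_ (norm_le_pi_norm θ a)
  by_contra hlt
  rw [Real.norm_eq_abs, not_le, abs_lt] at hlt
  have := Real.pi_gt_three
  exact ha ⟨by linarith, by linarith⟩

/-- Comparison of the lattice Fourier integral of the walk with the one of the Gaussian law. -/
lemma IsJumpKernel.exists_norm_setIntegral_sub_integral_le {d : ℕ} (hd : 1 ≤ d)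
    {p : (Fin d → ℤ) → (Fin d → ℤ) → ℝ} (hp : IsJumpKernel p) {S : Finset (Fin d → ℤ)}
    (hS : ∀ z ∉ S, p 0 z = 0) :
    ∃ A : ℝ, 0 ≤ A ∧ ∀ t : ℝ, 1 ≤ t → ∀ x : Fin d → ℤ,
      ‖(∫ θ in torusBox d, latticeChar θ (-x) * (Real.exp (-(t * jumpExponent S p θ)) : ℝ))
        - ∫ θ : Fin d → ℝ, latticeChar θ (-x) *
          (Real.exp (-(t * (θ ⬝ᵥ (jumpCovariance p *ᵥ θ) / 2))) : ℝ)‖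
        ≤ A / (Real.sqrt t ^ d * Real.sqrt t) := by
  obtain ⟨c₁, hc₁, h₁⟩ := hp.exists_mul_norm_sq_le_jumpExponent hS
  obtain ⟨c₂, hc₂, h₂⟩ := hp.exists_mul_norm_sq_le_jumpAverage_sq hS
  obtain ⟨K, hK, hKle⟩ := hp.exists_abs_jumpExponent_sub_le (S := S)
  -- This makes `Fin d → ℝ` nontrivial, as integration in polar coordinates requires.
  have : Nonempty (Fin d) := ⟨⟨0, hd⟩⟩
  set c : ℝ := min c₁ (c₂ / 2) with hc
  have hcpos : 0 < c := lt_min hc₁ (by linarith)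
  set q : (Fin d → ℝ) → ℝ := fun θ => θ ⬝ᵥ (jumpCovariance p *ᵥ θ) / 2 with hq
  have hqle : ∀ θ, c * ‖θ‖ ^ 2 ≤ q θ := fun θ => by
    rw [hq]
    simp only
    rw [dotProduct_jumpCovariance_mulVec hS]
    have := mul_le_mul_of_nonneg_right (min_le_right c₁ (c₂ / 2)) (sq_nonneg ‖θ‖)
    linarith [h₂ θ]
  have hψle : ∀ θ ∈ torusBox d, c * ‖θ‖ ^ 2 ≤ jumpExponent S p θ := fun θ hθ =>
    (mul_le_mul_of_nonneg_right (min_le_left c₁ (c₂ / 2)) (sq_nonneg ‖θ‖)).trans (h₁ θ hθ)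
  have hψq : ∀ θ, |jumpExponent S p θ - q θ| ≤ K * ‖θ‖ ^ 3 := fun θ => by
    rw [hq]
    simp only
    rw [dotProduct_jumpCovariance_mulVec hS]
    exact hKle θ
  have hqc : Continuous q := by
    rw [hq]
    simp only [dotProduct, Matrix.mulVec]
    fun_prop
  have hψc : Continuous (jumpExponent S p) := by
    unfold jumpExponent jumpAverage dotProduct
    fun_prop
  set f : (Fin d → ℝ) → ℝ := fun u => ‖u‖ ^ 3 * Real.exp (-c * ‖u‖ ^ 2) with hf
  have hfI : Integrable f := integrable_norm_pow_mul_exp_neg_mul_sq volume 3 hcpos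
  have hf0 : 0 ≤ ∫ u, f u := integral_nonneg fun u => by positivity
  -- `K` accounts for the cubic error inside the box, `1` for the Gaussian tail outside it.
  refine ⟨(K + 1) * ∫ u, f u, by positivity, fun t ht x => ?_⟩
  have ht0 : 0 < t := by linarith
  have hst : 0 < Real.sqrt t := Real.sqrt_pos.2 ht0
  have hss : Real.sqrt t ^ 2 = t := Real.sq_sqrt ht0.le
  have hscale : ∀ θ : Fin d → ℝ, f (Real.sqrt t • θ)
      = Real.sqrt t ^ 3 * (‖θ‖ ^ 3 * Real.exp (-(t * (c * ‖θ‖ ^ 2)))) := fun θ => by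
    simp only [hf, norm_smul, Real.norm_of_nonneg hst.le, mul_pow, hss]
    ring_nf
  have hbound : ∀ θ : Fin d → ℝ,
      ‖(torusBox d).indicator (fun θ => latticeChar θ (-x) *
          ((Real.exp (-(t * jumpExponent S p θ)) : ℝ) : ℂ)) θ
        - latticeChar θ (-x) * ((Real.exp (-(t * q θ)) : ℝ) : ℂ)‖
      ≤ (K + 1) / Real.sqrt t * f (Real.sqrt t • θ) := by
    intro θ
    have hR : (K + 1) / Real.sqrt t * f (Real.sqrt t • θ)
        = (K + 1) * (t * ‖θ‖ ^ 3 * Real.exp (-(t * (c * ‖θ‖ ^ 2)))) := by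
      rw [hscale, div_mul_eq_mul_div, div_eq_iff hst.ne', pow_succ (Real.sqrt t), hss]
      ring
    rw [hR]
    have hX : 0 ≤ t * ‖θ‖ ^ 3 * Real.exp (-(t * (c * ‖θ‖ ^ 2))) := by positivity
    by_cases hθ : θ ∈ torusBox d
    · rw [Set.indicator_of_mem hθ, ← mul_sub, norm_mul, norm_latticeChar, one_mul,
        ← Complex.ofReal_sub, Complex.norm_real, Real.norm_eq_abs]
      refine (abs_exp_neg_sub_exp_neg_le (mul_le_mul_of_nonneg_left (hψle θ hθ) ht0.le)
        (mul_le_mul_of_nonneg_left (hqle θ) ht0.le)).trans ?_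
      rw [← mul_sub, abs_mul, abs_of_pos ht0]
      calc t * |jumpExponent S p θ - q θ| * Real.exp (-(t * (c * ‖θ‖ ^ 2)))
          ≤ t * (K * ‖θ‖ ^ 3) * Real.exp (-(t * (c * ‖θ‖ ^ 2))) := by gcongr; exact hψq θ
        _ = K * (t * ‖θ‖ ^ 3 * Real.exp (-(t * (c * ‖θ‖ ^ 2)))) := by ring
        _ ≤ _ := by gcongr; linarith
    · rw [Set.indicator_of_notMem hθ, zero_sub, norm_neg, norm_mul, norm_latticeChar, one_mul,
        Complex.norm_real, Real.norm_of_nonneg (Real.exp_nonneg _)]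
      -- Outside the box the cubic weight is at least 1, so the same majorant absorbs the tail; this
      -- uses `t ≥ 1`.
      have h3 : 1 ≤ t * ‖θ‖ ^ 3 :=
        one_le_mul_of_one_le_of_one_le ht (one_le_pow₀ (one_le_norm_of_notMem_torusBox hθ))
      have hexp : Real.exp (-(t * q θ)) ≤ Real.exp (-(t * (c * ‖θ‖ ^ 2))) :=
        Real.exp_le_exp.2 (neg_le_neg (mul_le_mul_of_nonneg_left (hqle θ) ht0.le))
      calc Real.exp (-(t * q θ)) ≤ 1 * (1 * Real.exp (-(t * (c * ‖θ‖ ^ 2)))) := by simpa using hexp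
        _ ≤ _ := by gcongr; linarith
  have hI1 : Integrable (fun θ : Fin d → ℝ => latticeChar θ (-x) *
      ((Real.exp (-(t * q θ)) : ℝ) : ℂ)) := by
    have hg := integrable_norm_pow_mul_exp_neg_mul_sq (E := Fin d → ℝ) volume 0
      (mul_pos ht0 hcpos)
    refine hg.mono' ?_ (ae_of_all _ fun θ => ?_)
    · have := continuous_latticeChar_left (-x)
      exact Continuous.aestronglyMeasurable (by fun_prop)
    · rw [norm_mul, norm_latticeChar, one_mul, Complex.norm_real,
        Real.norm_of_nonneg (Real.exp_nonneg _), pow_zero, one_mul]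
      refine Real.exp_le_exp.2 ?_
      have := mul_le_mul_of_nonneg_left (hqle θ) ht0.le
      linarith
  have hI2 : Integrable ((torusBox d).indicator fun θ : Fin d → ℝ => latticeChar θ (-x) *
      ((Real.exp (-(t * jumpExponent S p θ)) : ℝ) : ℂ)) := by
    rw [integrable_indicator_iff (measurableSet_torusBox d)]
    refine Measure.integrableOn_of_bounded (M := 1) (volume_torusBox_lt_top d).ne ?_ ?_
    · have := continuous_latticeChar_left (-x)
      exact Continuous.aestronglyMeasurable (by fun_prop)
    · refine (ae_restrict_iff' (measurableSet_torusBox d)).2 (ae_of_all _ fun θ hθ => ?_)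
      rw [norm_mul, norm_latticeChar, one_mul, Complex.norm_real,
        Real.norm_of_nonneg (Real.exp_nonneg _)]
      refine Real.exp_le_one_iff.2 (neg_nonpos.2 (mul_nonneg ht0.le ?_))
      exact le_trans (by positivity) (hψle θ hθ)
  rw [← integral_indicator (measurableSet_torusBox d), ← integral_sub hI2 hI1]
  refine (norm_integral_le_of_norm_le
    ((hfI.comp_smul hst.ne').const_mul _) (ae_of_all _ hbound)).trans (le_of_eq ?_)
  -- The substitution `u = √t θ` contributes `√t ^ (-d)`; the remaining `1/√t` is already in the
  -- majorant.
  rw [integral_const_mul, Measure.integral_comp_smul, Module.finrank_fin_fun,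
    abs_of_nonneg (by positivity), smul_eq_mul]
  field_simp

/-- Local central limit theorem, additive form. -/
lemma IsJumpKernel.exists_abs_real_sub_gaussianDensity_le {d : ℕ} (hd : 1 ≤ d)
    {p : (Fin d → ℤ) → (Fin d → ℤ) → ℝ} (hp : IsJumpKernel p) :
    ∃ A : ℝ, 0 ≤ A ∧ ∀ (Ω : Type*) [MeasurableSpace Ω] (P : Measure Ω) [IsProbabilityMeasure P]
      (X : ℝ≥0 → Ω → (Fin d → ℤ)), IsContinuousTimeRandomWalk p P X →
      ∀ t : ℝ≥0, 1 ≤ t → ∀ x : Fin d → ℤ,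
        |P.real {ω | X t ω = x} - gaussianDensity (jumpCovariance p) t x|
          ≤ A / (Real.sqrt t ^ d * Real.sqrt t) := by
  obtain ⟨S, h0, hneg, hS⟩ := hp.exists_support
  obtain ⟨A, hA, h⟩ := hp.exists_norm_setIntegral_sub_integral_le hd hS
  refine ⟨A, hA, fun Ω _ P _ X hX t ht x => (?_ : _ ≤ _)⟩
  have ht0 : 0 < t := lt_of_lt_of_le one_pos ht
  have hb := h t (by exact_mod_cast ht) x
  have hinv := setIntegral_latticeChar_mul_integral P (hX.measurable t) x
  simp_rw [hX.integral_latticeChar hp h0 hneg hS ht0] at hinv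
  rw [hinv, integral_latticeChar_mul_gaussian hp.posDef_jumpCovariance (by exact_mod_cast ht0),
    ← mul_sub, norm_mul, ← Complex.ofReal_sub, Complex.norm_real, Real.norm_eq_abs] at hb
  -- The factor `(2π)^d` common to both inversion formulas is at least 1 and is dropped.
  refine le_trans (le_mul_of_one_le_left (abs_nonneg _) ?_) hb
  rw [norm_pow, norm_mul, Complex.norm_real, Complex.norm_ofNat,
    Real.norm_of_nonneg Real.pi_pos.le]
  exact one_le_pow₀ (by linarith [Real.pi_gt_three])

/-! ### Gaussian lower bound, the isotropic case and the ratio estimate. -/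

lemma dotProduct_mulVec_latticeVec_le {d : ℕ} (A : Matrix (Fin d) (Fin d) ℝ) (x : Fin d → ℤ) :
    latticeVec x ⬝ᵥ (A *ᵥ latticeVec x) ≤ (∑ a, ∑ b, |A a b|) * euclNorm x ^ 2 := by
  have hle : ∀ a, |latticeVec x a| ≤ euclNorm x := fun a =>
    PiLp.norm_apply_le (WithLp.toLp 2 (latticeVec x)) a
  simp only [dotProduct, Matrix.mulVec, Finset.mul_sum, Finset.sum_mul]
  refine Finset.sum_le_sum fun a _ => Finset.sum_le_sum fun b _ => ?_
  calc latticeVec x a * (A a b * latticeVec x b)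
      ≤ |latticeVec x a * (A a b * latticeVec x b)| := le_abs_self _
    _ = |A a b| * (|latticeVec x a| * |latticeVec x b|) := by rw [abs_mul, abs_mul]; ring
    _ ≤ |A a b| * (euclNorm x * euclNorm x) := by
        gcongr
        exacts [norm_nonneg _, hle a, hle b]
    _ = _ := by ring

/-- Lower bound for the Gaussian density in the diffusive region. -/
lemma exists_le_gaussianDensity {d : ℕ} {Γ : Matrix (Fin d) (Fin d) ℝ} (hΓ : 0 < Γ.det)
    (M : ℝ) :
    ∃ B : ℝ, 0 < B ∧ ∀ t : ℝ, 0 < t → ∀ x : Fin d → ℤ, euclNorm x ≤ M * Real.sqrt t →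
      B / Real.sqrt t ^ d ≤ gaussianDensity Γ t x := by
  have hsd := Real.sqrt_pos.2 hΓ
  set L := ∑ a, ∑ b, |Γ⁻¹ a b|
  have hL : 0 ≤ L := Finset.sum_nonneg fun a _ => Finset.sum_nonneg fun b _ => abs_nonneg _
  -- The prefactor at `t = 1`, times the exponential at its worst value, since `x·Γ⁻¹x ≤ L M² t` in
  -- this region.
  refine ⟨1 / ((2 * Real.pi) ^ ((d : ℝ) / 2) * Real.sqrt Γ.det) * Real.exp (-(L * M ^ 2) / 2),
    by positivity, fun t ht x hx => ?_⟩
  have hst : 0 < Real.sqrt t := Real.sqrt_pos.2 ht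
  have hpow : (2 * Real.pi * t) ^ ((d : ℝ) / 2)
      = (2 * Real.pi) ^ ((d : ℝ) / 2) * Real.sqrt t ^ d := by
    rw [Real.mul_rpow (by positivity) ht.le, Real.sqrt_eq_rpow, ← Real.rpow_natCast,
      ← Real.rpow_mul ht.le]
    ring_nf
  have hquad : latticeVec x ⬝ᵥ (Γ⁻¹ *ᵥ latticeVec x) ≤ L * M ^ 2 * t := by
    refine (dotProduct_mulVec_latticeVec_le _ _).trans ?_
    have h2 : euclNorm x ^ 2 ≤ M ^ 2 * t := by
      rw [← Real.sq_sqrt ht.le, ← mul_pow]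
      exact pow_le_pow_left₀ (norm_nonneg _) hx 2
    rw [mul_assoc]
    gcongr
  have hexp : Real.exp (-(L * M ^ 2) / 2)
      ≤ Real.exp (-(latticeVec x ⬝ᵥ (Γ⁻¹ *ᵥ latticeVec x)) / (2 * t)) := by
    refine Real.exp_le_exp.2 ?_
    rw [neg_div, neg_div, neg_le_neg_iff, div_le_div_iff₀ (by positivity) two_pos]
    linarith
  rw [gaussianDensity, hpow]
  calc _ = 1 / ((2 * Real.pi) ^ ((d : ℝ) / 2) * Real.sqrt t ^ d * Real.sqrt Γ.det)
        * Real.exp (-(L * M ^ 2) / 2) := by field_simp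
    _ ≤ _ := by gcongr

lemma gaussianDensity_smul_one {d : ℕ} (hd : 1 ≤ d) {t : ℝ} (x : Fin d → ℤ) :
    gaussianDensity ((1 / (d : ℝ)) • (1 : Matrix (Fin d) (Fin d) ℝ)) t x =
      Real.sqrt d ^ d / (2 * Real.pi * t) ^ ((d : ℝ) / 2) *
        Real.exp (-(d * euclNorm x ^ 2) / (2 * t)) := by
  have hd0 : (0 : ℝ) < d := by exact_mod_cast hd
  have hinv : ((1 / (d : ℝ)) • (1 : Matrix (Fin d) (Fin d) ℝ))⁻¹ = (d : ℝ) • 1 := by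
    refine Matrix.inv_eq_right_inv ?_
    rw [Matrix.smul_mul, Matrix.one_mul, smul_smul, one_div_mul_cancel hd0.ne', one_smul]
  have hdet : Real.sqrt ((1 / (d : ℝ)) • (1 : Matrix (Fin d) (Fin d) ℝ)).det
      = (Real.sqrt d ^ d)⁻¹ := by
    rw [Matrix.det_smul, Matrix.det_one, mul_one, Fintype.card_fin, one_div, inv_pow,
      Real.sqrt_inv]
    congr 1
    exact (Real.sqrt_eq_iff_mul_self_eq (by positivity) (by positivity)).2
      (by rw [← mul_pow, Real.mul_self_sqrt hd0.le])
  have hnorm : latticeVec x ⬝ᵥ latticeVec x = euclNorm x ^ 2 := by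
    rw [euclNorm, EuclideanSpace.real_norm_sq_eq]
    simp [dotProduct, pow_two]
  rw [gaussianDensity, hinv, hdet, Matrix.smul_mulVec, Matrix.one_mulVec, dotProduct_smul, hnorm,
    smul_eq_mul]
  congr 1
  rw [one_div, mul_inv, inv_inv, mul_comm, ← div_eq_mul_inv]

end Estimate

theorem theorem6p2 (d : ℕ) (hd : 1 ≤ d) (p : (Fin d → ℤ) → (Fin d → ℤ) → ℝ)
    (hp : IsJumpKernel p) :
    (∀ M : ℝ, 0 ≤ M → ∃ c : ℝ, 0 < c ∧
      ∀ (Ω : Type*) [MeasurableSpace Ω] (P : Measure Ω) [IsProbabilityMeasure P]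
        (X : ℝ≥0 → Ω → (Fin d → ℤ)), IsContinuousTimeRandomWalk p P X →
        ∀ t : ℝ≥0, 0 < t → ∀ x : Fin d → ℤ, euclNorm x ≤ M * Real.sqrt t →
          |P.real {ω | X t ω = x} / gaussianDensity (jumpCovariance p) t x - 1|
            ≤ c / Real.sqrt t) ∧
    (jumpCovariance p = (1 / (d : ℝ)) • (1 : Matrix (Fin d) (Fin d) ℝ) →
      ∀ t : ℝ, 0 < t → ∀ x : Fin d → ℤ,
        gaussianDensity (jumpCovariance p) t x =
          Real.sqrt d ^ d / (2 * Real.pi * t) ^ ((d : ℝ) / 2) *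
            Real.exp (-(d * euclNorm x ^ 2) / (2 * t))) := by
  refine ⟨fun M _ => ?_, fun hΓ t _ x => by rw [hΓ]; exact gaussianDensity_smul_one hd x⟩
  obtain ⟨A, hA, hadd⟩ := hp.exists_abs_real_sub_gaussianDensity_le hd
  obtain ⟨B, hB, hlow⟩ := exists_le_gaussianDensity hp.posDef_jumpCovariance.det_pos M
  -- `A / B` serves `t ≥ 1`; `1 / B + 1` serves `t < 1`, where the probability is bounded by 1 and
  -- `√t ^ d ≤ 1`.
  refine ⟨A / B + 1 / B + 1, by positivity, fun Ω _ P _ X hX t ht x hx => (?_ : _ ≤ _)⟩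
  have hst : 0 < Real.sqrt t := Real.sqrt_pos.2 (by exact_mod_cast ht)
  have hg := hlow t (by exact_mod_cast ht) x hx
  set g := gaussianDensity (jumpCovariance p) t x
  have hg0 : 0 < g := lt_of_lt_of_le (by positivity) hg
  rcases le_or_gt 1 t with h1 | h1
  · rw [div_sub_one hg0.ne', abs_div, abs_of_pos hg0]
    calc |P.real {ω | X t ω = x} - g| / g
        ≤ A / (Real.sqrt t ^ d * Real.sqrt t) / (B / Real.sqrt t ^ d) := by
          gcongr
          exact hadd Ω P X hX t h1 x
      _ = A / B / Real.sqrt t := by field_simp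
      _ ≤ _ := by
          gcongr
          linarith [one_div_pos.2 hB]
  · have hs1 : Real.sqrt t ≤ 1 := Real.sqrt_le_one.2 (by exact_mod_cast h1.le)
    have hratio : P.real {ω | X t ω = x} / g ≤ 1 / B := by
      calc P.real {ω | X t ω = x} / g ≤ 1 / (B / Real.sqrt t ^ d) := by
            gcongr
            exact measureReal_le_one
        _ = Real.sqrt t ^ d / B := by field_simp
        _ ≤ 1 / B := by
            gcongr
            exact pow_le_one₀ hst.le hs1
    have hratio0 : 0 ≤ P.real {ω | X t ω = x} / g := by positivity
    have hAB : 0 ≤ A / B := by positivity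
    have hB1 : 0 ≤ 1 / B := by positivity
    calc |P.real {ω | X t ω = x} / g - 1| ≤ A / B + 1 / B + 1 := by
          rw [abs_le]
          constructor <;> linarith
      _ ≤ _ := by
          rw [le_div_iff₀ hst]
          exact mul_le_of_le_one_right (by linarith) hs1
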